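/- Let $n\ge 0$ be an integer and let $\{P_i : i\in I\}$ be a finite family of convex sets in $\mathbb R^n$, each of which is symmetric (that is, $x\in P_i$ implies $-x\in P_i$), such that $\bigcap_{i\in I}P_i$ has non-empty interior. Then for every real number $d>1$ there exist an integer $0\le s\le dn$ and (not necessarily distinct) indices $i_1,\dots,i_s\in I$ such that $$P_{i_1}\cap\cdots\cap P_{i_s}\subseteq \gamma_d\sqrt n\,\Bigl(\bigcap_{i\in I}P_i\Bigr),\qquad \gamma_d:=\frac{\sqrt d+1}{\sqrt d-1},$$ where $tK=\{tx : x\in K\}$ and the intersection of an empty family of sets is $\mathbb R^n$. -/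

import Mathlib

open scoped Pointwise

/-- The constant `γ_d = (√d + 1) / (√d - 1)`, used for `d > 1`. -/
noncomputable def gammaConst (d : ℝ) : ℝ := (√d + 1) / (√d - 1)

/-- A set `K` is (origin-)symmetric if `x ∈ K` implies `-x ∈ K`. -/
def IsSymmetricSet {E : Type*} [Neg E] (K : Set E) : Prop := ∀ x ∈ K, -x ∈ K

/-!
Let `V` be the union of the polars of the sets `P i`. Each polar is compact, because the
intersection has an interior point and hence, by symmetry, every `P i` contains a neighbourhood of
`0`. By the Hahn-Banach theorem, `x ∈ R • P k` as soon as `⟪w, x⟫ < R` for all `w` in the polar of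
`P k` (`inv_smul_mem_of_inner_le`; the strict inequality makes closedness of the `P k` unnecessary).
So it suffices to choose `s ≤ d n` vectors `v j ∈ V` such that `|⟪v j, x⟫| ≤ 1` for all `j` implies
`⟪w, x⟫ < γ_d √n` for all `w ∈ V`; the index of a polar containing `v j` is then the `j`-th index
asked for.

Let `m` be the dimension of the span of `V` and `s = ⌊d m⌋ ≥ m`. Among all `s`-tuples in `V`, take
one that maximizes the determinant of `M = ∑ j, v j (v j)ᵀ`, in coordinates on the span. Put
`τ(u, w) = uᵀ M⁻¹ w`. Exchanging `v j` for `w` multiplies the determinant by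
`(1 - τ(v j, v j)) (1 + τ(w, w)) + τ(v j, w) ^ 2` (`det_sumOuter_update`), which is therefore at
most `1`. Summing over `j` and using `∑ j, τ(v j, v j) = m` and `∑ j, τ(v j, w) ^ 2 = τ(w, w)` gives
`τ(w, w) ≤ m / (s - m + 1)` (`leverage_le_of_det_update_le`). By the Cauchy-Schwarz inequality,
`⟪w, x⟫ ^ 2 ≤ τ(w, w) ∑ j, ⟪v j, x⟫ ^ 2 ≤ m s / (s - m + 1)` (`exists_tuple_bound`), and the last
quantity is at most `m d / (d - 1)`, which is smaller than `γ_d ^ 2 n`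
(`floor_div_lt_gammaConst_sq`).
-/

open Matrix

/-! ### The matrix `∑ j, v j (v j)ᵀ` under exchange of one vector -/

/-- The matrix `∑ j, v j (v j)ᵀ` of a tuple `v` of coordinate vectors. -/
def sumOuter {κ m : Type*} [Fintype κ] (v : κ → m → ℝ) : Matrix m m ℝ :=
  (Matrix.of v)ᵀ * Matrix.of v

section SumOuter

variable {κ m : Type*} [Fintype κ]

lemma sumOuter_apply (v : κ → m → ℝ) (a b : m) :
    sumOuter v a b = ∑ j, v j a * v j b := by
  simp [sumOuter, Matrix.mul_apply]

lemma transpose_sumOuter (v : κ → m → ℝ) : (sumOuter v)ᵀ = sumOuter v := by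
  simp [sumOuter]

variable [Fintype m]

lemma dotProduct_sumOuter_mulVec (v : κ → m → ℝ) (x y : m → ℝ) :
    x ⬝ᵥ (sumOuter v *ᵥ y) = ∑ j, (v j ⬝ᵥ x) * (v j ⬝ᵥ y) := by
  rw [sumOuter, ← Matrix.mulVec_mulVec, Matrix.dotProduct_mulVec, Matrix.vecMul_transpose]
  rfl

variable [DecidableEq m]

lemma det_sumOuter_nonneg (v : κ → m → ℝ) : 0 ≤ (sumOuter v).det := by
  have h := Matrix.posSemidef_conjTranspose_mul_self (Matrix.of v)
  rw [Matrix.conjTranspose_eq_transpose_of_trivial] at h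
  exact h.det_nonneg

/-- A spanning tuple has a nonsingular matrix. -/
lemma det_sumOuter_pos {v : κ → m → ℝ} (hv : Submodule.span ℝ (Set.range v) = ⊤) :
    0 < (sumOuter v).det := by
  refine lt_of_le_of_ne (det_sumOuter_nonneg v) fun h ↦ ?_
  obtain ⟨x, hx0, hx⟩ := Matrix.exists_mulVec_eq_zero_iff.2 h.symm
  have hsum := dotProduct_sumOuter_mulVec v x x
  rw [hx, dotProduct_zero] at hsum
  have hz : ∀ j, v j ⬝ᵥ x = 0 := fun j ↦ by
    have := (Finset.sum_eq_zero_iff_of_nonneg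
      (fun j _ ↦ mul_self_nonneg (v j ⬝ᵥ x))).1 hsum.symm j (Finset.mem_univ j)
    simpa using this
  have hall : ∀ y : m → ℝ, y ⬝ᵥ x = 0 := fun y ↦ by
    have hy : y ∈ Submodule.span ℝ (Set.range v) := hv ▸ Submodule.mem_top
    induction hy using Submodule.span_induction with
    | mem y hy => obtain ⟨j, rfl⟩ := hy; exact hz j
    | zero => simp
    | add y z _ _ hy hz => rw [add_dotProduct, hy, hz, add_zero]
    | smul c y _ hy => rw [smul_dotProduct, hy, smul_zero]
  exact hx0 (dotProduct_self_eq_zero.1 (hall x))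

/-- Two-column matrix determinant lemma for the exchange of `v j` for `w`. -/
lemma det_sumOuter_update [DecidableEq κ] {v : κ → m → ℝ} (hv : IsUnit (sumOuter v).det)
    (j : κ) (w : m → ℝ) :
    (sumOuter (Function.update v j w)).det = (sumOuter v).det *
      ((1 - v j ⬝ᵥ ((sumOuter v)⁻¹ *ᵥ v j)) * (1 + w ⬝ᵥ ((sumOuter v)⁻¹ *ᵥ w))
        + (v j ⬝ᵥ ((sumOuter v)⁻¹ *ᵥ w)) ^ 2) := by
  set M := sumOuter v with hM
  let R : Matrix (Fin 2) m ℝ := Matrix.of ![v j, w]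
  let C : Matrix m (Fin 2) ℝ := (Matrix.of ![-v j, w])ᵀ
  have hupd : sumOuter (Function.update v j w) = M + C * R := by
    ext a b
    simp only [hM, sumOuter_apply, Matrix.add_apply, Matrix.mul_apply, Fin.sum_univ_two, C, R]
    rw [← Finset.add_sum_erase _ _ (Finset.mem_univ j),
      ← Finset.add_sum_erase _ (fun j ↦ v j a * v j b) (Finset.mem_univ j)]
    have : ∀ i ∈ Finset.univ.erase j,
        Function.update v j w i a * Function.update v j w i b = v i a * v i b := by
      intro i hi
      rw [Function.update_of_ne (Finset.ne_of_mem_erase hi)]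
    rw [Finset.sum_congr rfl this]
    simp
    ring
  have hentry : ∀ k l, (R * M⁻¹ * C) k l = R k ⬝ᵥ (M⁻¹ *ᵥ Cᵀ l) := by
    intro k l
    rw [Matrix.mul_assoc, Matrix.mul_apply_eq_vecMul, Matrix.dotProduct_mulVec]
    rw [← Matrix.vecMul_vecMul]
    rfl
  have hsymm : w ⬝ᵥ (M⁻¹ *ᵥ v j) = v j ⬝ᵥ (M⁻¹ *ᵥ w) := by
    rw [Matrix.dotProduct_mulVec, ← Matrix.mulVec_transpose, Matrix.transpose_nonsing_inv,
      hM, transpose_sumOuter, dotProduct_comm]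
  rw [hupd, Matrix.det_add_mul _ _ hv, Matrix.det_fin_two]
  simp only [Matrix.add_apply, hentry]
  have r0 : R 0 = v j := rfl
  have r1 : R 1 = w := rfl
  have c0 : Cᵀ 0 = -v j := rfl
  have c1 : Cᵀ 1 = w := rfl
  rw [r0, r1, c0, c1]
  simp only [Matrix.mulVec_neg, dotProduct_neg, hsymm, Matrix.one_apply_eq,
    Matrix.one_apply_ne zero_ne_one, Matrix.one_apply_ne one_ne_zero]
  ring

/-- The leverage scores `v j ⬝ᵥ M⁻¹ (v j)`, where `M = ∑ j, v j (v j)ᵀ`, add up to the dimension. -/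
lemma sum_leverage {v : κ → m → ℝ} (hv : IsUnit (sumOuter v).det) :
    ∑ j, v j ⬝ᵥ ((sumOuter v)⁻¹ *ᵥ v j) = Fintype.card m := by
  have h : ∑ j, v j ⬝ᵥ ((sumOuter v)⁻¹ *ᵥ v j)
      = (Matrix.of v * ((sumOuter v)⁻¹ * (Matrix.of v)ᵀ)).trace := rfl
  rw [h, Matrix.trace_mul_comm, Matrix.mul_assoc]
  change ((sumOuter v)⁻¹ * sumOuter v).trace = _
  rw [Matrix.nonsing_inv_mul _ hv, Matrix.trace_one]

lemma sum_sq_dotProduct_inv_mulVec {v : κ → m → ℝ} (hv : IsUnit (sumOuter v).det) (w : m → ℝ) :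
    ∑ j, (v j ⬝ᵥ ((sumOuter v)⁻¹ *ᵥ w)) ^ 2 = w ⬝ᵥ ((sumOuter v)⁻¹ *ᵥ w) := by
  have h := dotProduct_sumOuter_mulVec v ((sumOuter v)⁻¹ *ᵥ w) ((sumOuter v)⁻¹ *ᵥ w)
  rw [Matrix.mulVec_mulVec, Matrix.mul_nonsing_inv _ hv, Matrix.one_mulVec, dotProduct_comm] at h
  rw [h]
  exact Finset.sum_congr rfl fun j _ ↦ pow_two _

/-- If no exchange of one `v j` for `w` increases the determinant of `M = ∑ j, v j (v j)ᵀ`, then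
`w ⬝ᵥ M⁻¹ w` is at most `m / (s - m + 1)`, where `s` is the number of vectors and `m` the
dimension. -/
lemma leverage_le_of_det_update_le [DecidableEq κ] {v : κ → m → ℝ} (hv : 0 < (sumOuter v).det)
    {w : m → ℝ}
    (hmax : ∀ j, (sumOuter (Function.update v j w)).det ≤ (sumOuter v).det) :
    w ⬝ᵥ ((sumOuter v)⁻¹ *ᵥ w) * (Fintype.card κ - Fintype.card m + 1) ≤ Fintype.card m := by
  have hu : IsUnit (sumOuter v).det := hv.ne'.isUnit
  set y := (sumOuter v)⁻¹ *ᵥ w with hy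
  have hj : ∀ j, (1 - v j ⬝ᵥ ((sumOuter v)⁻¹ *ᵥ v j)) * (1 + w ⬝ᵥ y) + (v j ⬝ᵥ y) ^ 2 ≤ 1 := by
    intro j
    have h := hmax j
    rw [det_sumOuter_update hu] at h
    exact le_of_mul_le_mul_left (by simpa using h) hv
  have hsq := sum_sq_dotProduct_inv_mulVec hu w
  rw [← hy] at hsq
  have hsum := Finset.sum_le_sum fun j (_ : j ∈ Finset.univ) ↦ hj j
  rw [Finset.sum_add_distrib, ← Finset.sum_mul, Finset.sum_sub_distrib, sum_leverage hu, hsq] at hsum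
  simp only [Finset.sum_const, Finset.card_univ, nsmul_eq_mul, mul_one] at hsum
  linarith

end SumOuter

/-! ### Compact sets of vectors and determinant-maximizing tuples -/

/-- Among the tuples of `s` vectors of a compact spanning set, one that maximizes
`det M`, `M = ∑ j, v j (v j)ᵀ`, controls the whole set: by Cauchy-Schwarz,
`(w ⬝ᵥ x) ^ 2 ≤ (w ⬝ᵥ M⁻¹ w) * ∑ j, (v j ⬝ᵥ x) ^ 2`. -/
lemma exists_tuple_bound_of_span_eq_top {m : ℕ} (hm : 0 < m) {s : ℕ} (hs : m ≤ s)
    {V : Set (Fin m → ℝ)} (hV : IsCompact V) (hspan : Submodule.span ℝ V = ⊤) :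
    ∃ v : Fin s → Fin m → ℝ, (∀ j, v j ∈ V) ∧ ∀ x, (∀ j, |v j ⬝ᵥ x| ≤ 1) →
      ∀ w ∈ V, (w ⬝ᵥ x) ^ 2 * (s - m + 1) ≤ m * s := by
  obtain ⟨f, hfV, hfspan, -⟩ := Submodule.exists_fun_fin_finrank_span_eq ℝ V
  have hfin : Module.finrank ℝ (Submodule.span ℝ V) = m := by
    rw [hspan, finrank_top, Module.finrank_fin_fun]
  -- A spanning tuple of length `s` in `V`: a basis, repeated cyclically.
  let u : Fin s → Fin m → ℝ := fun j ↦ f ⟨j % m, (Nat.mod_lt _ hm).trans_eq hfin.symm⟩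
  have hu : Submodule.span ℝ (Set.range u) = ⊤ := by
    rw [eq_top_iff, ← hspan, ← hfspan]
    refine Submodule.span_mono ?_
    rintro _ ⟨k, rfl⟩
    have hk : (k : ℕ) < m := k.2.trans_eq hfin
    exact ⟨⟨k, hk.trans_le hs⟩, congrArg f (Fin.ext (Nat.mod_eq_of_lt hk))⟩
  have hcont : Continuous fun v : Fin s → Fin m → ℝ ↦ (sumOuter v).det := by
    refine Continuous.matrix_det (continuous_matrix fun a b ↦ ?_)
    simp only [sumOuter_apply]
    fun_prop
  obtain ⟨v, hvV, hvmax⟩ := (isCompact_univ_pi fun _ : Fin s ↦ hV).exists_isMaxOn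
    ⟨u, fun j _ ↦ hfV _⟩ hcont.continuousOn
  have hvV' : ∀ j, v j ∈ V := fun j ↦ hvV j trivial
  have hdet : 0 < (sumOuter v).det :=
    (det_sumOuter_pos hu).trans_le (hvmax (a := u) fun j _ ↦ hfV _)
  refine ⟨v, hvV', fun x hx w hw ↦ ?_⟩
  have hlev := leverage_le_of_det_update_le hdet (w := w) fun j ↦ hvmax fun i _ ↦ by
    rcases eq_or_ne i j with rfl | hij
    · simpa using hw
    · simpa [hij] using hvV' i
  rw [Fintype.card_fin, Fintype.card_fin] at hlev
  set y := (sumOuter v)⁻¹ *ᵥ w with hy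
  have hMy : sumOuter v *ᵥ y = w := by
    rw [hy, Matrix.mulVec_mulVec, Matrix.mul_nonsing_inv _ hdet.ne'.isUnit, Matrix.one_mulVec]
  have hsq := sum_sq_dotProduct_inv_mulVec hdet.ne'.isUnit w
  rw [← hy] at hsq
  have hwx : w ⬝ᵥ x = ∑ j, (v j ⬝ᵥ x) * (v j ⬝ᵥ y) := by
    rw [dotProduct_comm, ← hMy, dotProduct_sumOuter_mulVec]
  have hxs : ∑ j, (v j ⬝ᵥ x) ^ 2 ≤ s := by
    calc ∑ j, (v j ⬝ᵥ x) ^ 2 ≤ ∑ _j : Fin s, (1 : ℝ) :=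
          Finset.sum_le_sum fun j _ ↦ (sq_le_one_iff_abs_le_one _).2 (hx j)
      _ = s := by simp
  have hcs := Finset.sum_mul_sq_le_sq_mul_sq Finset.univ (fun j ↦ v j ⬝ᵥ x) fun j ↦ v j ⬝ᵥ y
  rw [← hwx, hsq] at hcs
  have hτ : 0 ≤ w ⬝ᵥ y := hsq ▸ Finset.sum_nonneg fun j _ ↦ sq_nonneg _
  have hsm : (0 : ℝ) ≤ s - m + 1 := by
    have : (m : ℝ) ≤ s := by exact_mod_cast hs
    linarith
  calc (w ⬝ᵥ x) ^ 2 * (s - m + 1)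
      ≤ (s * (w ⬝ᵥ y)) * (s - m + 1) := by
        gcongr
        exact hcs.trans (mul_le_mul_of_nonneg_right hxs hτ)
    _ = s * (w ⬝ᵥ y * (s - m + 1)) := by ring
    _ ≤ s * m := by gcongr
    _ = m * s := mul_comm _ _

/-- Coordinate-free form of `exists_tuple_bound_of_span_eq_top`; the dimension that counts is that
of the span of `V`. -/
lemma exists_tuple_bound {E : Type*} [NormedAddCommGroup E] [NormedSpace ℝ E]
    [FiniteDimensional ℝ E] {V : Set E} (hV : IsCompact V) {m s : ℕ}
    (hm : Module.finrank ℝ (Submodule.span ℝ V) = m) (hm0 : 0 < m) (hs : m ≤ s) :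
    ∃ v : Fin s → E, (∀ j, v j ∈ V) ∧ ∀ f : E →ₗ[ℝ] ℝ, (∀ j, |f (v j)| ≤ 1) →
      ∀ w ∈ V, f w ^ 2 * (s - m + 1) ≤ m * s := by
  let W := Submodule.span ℝ V
  let b : Module.Basis (Fin m) ℝ W := Module.finBasisOfFinrankEq ℝ W hm
  let e : W ≃L[ℝ] (Fin m → ℝ) := b.equivFunL
  have hcpt : IsCompact (e '' ((↑) ⁻¹' V : Set W)) := by
    refine IsCompact.image ?_ e.continuous
    exact W.closed_of_finiteDimensional.isClosedEmbedding_subtypeVal.isCompact_preimage hV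
  have hspan : Submodule.span ℝ (e '' ((↑) ⁻¹' V : Set W)) = ⊤ := by
    have h : Submodule.span ℝ (e.toLinearEquiv.toLinearMap '' ((↑) ⁻¹' V : Set W)) = ⊤ := by
      rw [Submodule.span_image, Submodule.span_span_coe_preimage, Submodule.map_top,
        LinearEquiv.range]
    exact h
  obtain ⟨v, hvV, hv⟩ := exists_tuple_bound_of_span_eq_top hm0 hs hcpt hspan
  choose u huV hu using hvV
  have key : ∀ (f : E →ₗ[ℝ] ℝ) (w : W), f w = e w ⬝ᵥ fun i ↦ f (b i) := by
    intro f w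
    conv_lhs => rw [← b.sum_equivFun w]
    simp only [Submodule.coe_sum, Submodule.coe_smul, map_sum, map_smul, smul_eq_mul]
    rfl
  refine ⟨fun j ↦ u j, huV, fun f hf w hw ↦ ?_⟩
  have h := hv (fun i ↦ f (b i)) (fun j ↦ by rw [← hu, ← key]; exact hf j) _
    ⟨⟨w, Submodule.subset_span hw⟩, hw, rfl⟩
  rwa [← key] at h

/-! ### Polars of symmetric convex sets -/

section Polar

variable {E : Type*} [NormedAddCommGroup E] [InnerProductSpace ℝ E]

/-- The polar `{v | ∀ x ∈ K, ⟪v, x⟫ ≤ 1}` of a set `K` in a real inner product space. -/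
def innerPolar (K : Set E) : Set E := {v | ∀ x ∈ K, inner ℝ v x ≤ 1}

lemma isClosed_innerPolar (K : Set E) : IsClosed (innerPolar K) := by
  have h : innerPolar K = ⋂ x ∈ K, {v | inner ℝ v x ≤ 1} := by
    ext v; simp [innerPolar]
  rw [h]
  exact isClosed_biInter fun x _ ↦ isClosed_le (by fun_prop) continuous_const

lemma isBounded_innerPolar {K : Set E} (h0 : (0 : E) ∈ interior K) :
    Bornology.IsBounded (innerPolar K) := by
  obtain ⟨r, hr, hball⟩ := Metric.mem_nhds_iff.1 (mem_interior_iff_mem_nhds.1 h0)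
  refine isBounded_iff_forall_norm_le.2 ⟨2 / r, fun v hv ↦ ?_⟩
  rcases eq_or_ne v 0 with rfl | hv0
  · simp only [norm_zero]; positivity
  have hn : 0 < ‖v‖ := norm_pos_iff.2 hv0
  have hmem : (r / 2 / ‖v‖) • v ∈ K := hball <| by
    rw [mem_ball_zero_iff, norm_smul, Real.norm_of_nonneg (by positivity),
      div_mul_cancel₀ _ hn.ne']
    exact half_lt_self hr
  have h := hv _ hmem
  rw [real_inner_smul_right, real_inner_self_eq_norm_sq] at h
  rw [le_div_iff₀ hr]
  field_simp at h
  linarith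

lemma abs_inner_le_one_of_mem_innerPolar {K : Set E} (hK : IsSymmetricSet K) {v x : E}
    (hv : v ∈ innerPolar K) (hx : x ∈ K) : |inner ℝ v x| ≤ 1 := by
  have h := hv _ (hK x hx)
  rw [inner_neg_right] at h
  exact abs_le.2 ⟨by linarith, hv x hx⟩

/-- The center of symmetry of a convex set with nonempty interior is an interior point. -/
lemma zero_mem_interior_of_isSymmetricSet {K : Set E} (hconv : Convex ℝ K)
    (hK : IsSymmetricSet K) (hint : (interior K).Nonempty) : (0 : E) ∈ interior K := by
  obtain ⟨x, hx⟩ := hint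
  have hx' : -x ∈ interior K :=
    interior_maximal (fun y hy ↦ by simpa using hK _ (interior_subset hy))
      isOpen_interior.neg (by simpa using hx)
  simpa using hconv.interior hx hx' (by norm_num : (0 : ℝ) ≤ 1 / 2)
    (by norm_num : (0 : ℝ) ≤ 1 / 2) (by norm_num)

/-- A quantitative bipolar theorem. The strict inequality `r < R` is what allows `K` not to be
closed. -/
lemma inv_smul_mem_of_inner_le [FiniteDimensional ℝ E] {K : Set E} (hconv : Convex ℝ K)
    (h0 : (0 : E) ∈ interior K) {R : ℝ} (hR : 0 < R) {x : E}
    (hx : ∀ v ∈ innerPolar K, inner ℝ v x < R) : R⁻¹ • x ∈ K := by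
  by_contra hxK
  obtain ⟨f, hf⟩ := geometric_hahn_banach_open_point hconv.interior isOpen_interior
    fun h ↦ hxK (interior_subset h)
  have hpos : 0 < f (R⁻¹ • x) := by simpa using hf 0 h0
  have hle : ∀ y ∈ K, f y ≤ f (R⁻¹ • x) := fun y hy ↦ by
    have hy' : y ∈ closure (interior K) := by
      rw [hconv.closure_interior_eq_closure_of_nonempty_interior ⟨0, h0⟩]
      exact subset_closure hy
    exact closure_minimal (fun z hz ↦ (hf z hz).le)
      (isClosed_le f.continuous continuous_const) hy'
  let v : E := (f (R⁻¹ • x))⁻¹ • (InnerProductSpace.toDual ℝ E).symm f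
  have hv : ∀ y, inner ℝ v y = (f (R⁻¹ • x))⁻¹ * f y := fun y ↦ by
    rw [real_inner_smul_left, InnerProductSpace.toDual_symm_apply]
  have h := hx v fun y hy ↦ by
    rw [hv, inv_mul_le_iff₀ hpos, mul_one]
    exact hle y hy
  rw [hv, inv_mul_lt_iff₀ hpos, map_smul, smul_eq_mul] at h
  field_simp at h
  exact lt_irrefl _ h

end Polar

/-! ### The constant -/

/-- For `s = ⌊d m⌋` the factor `√(m s / (s - m + 1))` of `exists_tuple_bound` is smaller than
`γ_d √m`, because `s / (s - m + 1) ≤ d / (d - 1) < γ_d ^ 2`. -/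
lemma floor_div_lt_gammaConst_sq {d : ℝ} (hd : 1 < d) {m s : ℕ} (hm : 0 < m) (hms : m ≤ s)
    (hs : d * m < s + 1) : (s : ℝ) < gammaConst d ^ 2 * (s - m + 1) := by
  have hm1 : (1 : ℝ) ≤ m := by exact_mod_cast hm
  have hms' : (m : ℝ) ≤ s := by exact_mod_cast hms
  have hq : 1 < √d := by rw [Real.lt_sqrt zero_le_one]; simpa using hd
  have hdq : √d ^ 2 = d := Real.sq_sqrt (by linarith)
  have h1 : (s : ℝ) * (d - 1) ≤ d * (s - m + 1) := by nlinarith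
  have h2 : d < gammaConst d ^ 2 * (d - 1) := by
    have : gammaConst d ^ 2 * (d - 1) = (√d + 1) ^ 3 / (√d - 1) := by
      have : √d - 1 ≠ 0 := by linarith
      have hd1 : d - 1 = (√d - 1) * (√d + 1) := by linear_combination -hdq
      rw [gammaConst, hd1]
      field_simp
    rw [this, lt_div_iff₀ (by linarith)]
    nlinarith
  have hpos : (0 : ℝ) < s - m + 1 := by linarith
  refine lt_of_mul_lt_mul_right ?_ (by linarith : (0 : ℝ) ≤ d - 1)
  calc (s : ℝ) * (d - 1) ≤ d * (s - m + 1) := h1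
    _ < gammaConst d ^ 2 * (d - 1) * (s - m + 1) := by gcongr
    _ = gammaConst d ^ 2 * (s - m + 1) * (d - 1) := by ring

lemma gammaConst_pos {d : ℝ} (hd : 1 < d) : 0 < gammaConst d := by
  have hq : 1 < √d := by rw [Real.lt_sqrt zero_le_one]; simpa using hd
  exact div_pos (by linarith) (by linarith)

/-- From every compact set in an `n`-dimensional space, `n > 0`, one can choose at most `d n`
vectors such that a functional bounded by `1` on these is smaller than `γ_d √n` on the whole
set. -/
lemma exists_tuple_lt_gammaConst_mul_sqrt {E : Type*} [NormedAddCommGroup E] [NormedSpace ℝ E]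
    [FiniteDimensional ℝ E] {n : ℕ} (hn : Module.finrank ℝ E = n) (hn0 : 0 < n)
    {V : Set E} (hV : IsCompact V) {d : ℝ} (hd : 1 < d) :
    ∃ (s : ℕ) (v : Fin s → E), (s : ℝ) ≤ d * n ∧ (∀ j, v j ∈ V) ∧
      ∀ f : E →ₗ[ℝ] ℝ, (∀ j, |f (v j)| ≤ 1) → ∀ w ∈ V, f w < gammaConst d * √n := by
  have hγ := gammaConst_pos hd
  obtain ⟨m, hm⟩ : ∃ m, Module.finrank ℝ (Submodule.span ℝ V) = m := ⟨_, rfl⟩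
  have hmn : (m : ℝ) ≤ n := by
    rw [← hn, ← hm]; exact_mod_cast Submodule.finrank_le _
  have hR : 0 < gammaConst d * √n := mul_pos hγ (Real.sqrt_pos.2 (by exact_mod_cast hn0))
  rcases Nat.eq_zero_or_pos m with rfl | hm0
  · refine ⟨0, Fin.elim0, by simp; positivity, fun j ↦ j.elim0, fun f _ w hw ↦ ?_⟩
    have hw0 : w = 0 := by
      have := Submodule.finrank_eq_zero.1 hm
      exact Submodule.span_eq_bot.1 this w hw
    simpa [hw0] using hR
  have hdm : 0 ≤ d * m := by positivity
  have hs : m ≤ ⌊d * m⌋₊ := Nat.le_floor (le_mul_of_one_le_left (Nat.cast_nonneg m) hd.le)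
  obtain ⟨v, hvV, hv⟩ := exists_tuple_bound hV hm hm0 hs
  refine ⟨⌊d * m⌋₊, v, (Nat.floor_le hdm).trans (by gcongr), hvV, fun f hf w hw ↦ ?_⟩
  have hconst := floor_div_lt_gammaConst_sq hd hm0 hs (Nat.lt_floor_add_one _)
  have hb := hv f hf w hw
  have hmpos : (0 : ℝ) < m := by exact_mod_cast hm0
  have hspos : (0 : ℝ) < (⌊d * m⌋₊ : ℝ) - m + 1 := by
    have : (m : ℝ) ≤ ⌊d * m⌋₊ := by exact_mod_cast hs
    linarith
  refine lt_of_pow_lt_pow_left₀ 2 hR.le ?_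
  rw [mul_pow, Real.sq_sqrt (Nat.cast_nonneg n)]
  calc f w ^ 2 < gammaConst d ^ 2 * m := by
        refine lt_of_mul_lt_mul_right ?_ hspos.le
        calc _ ≤ _ := hb
          _ < m * (gammaConst d ^ 2 * (⌊d * m⌋₊ - m + 1)) := by gcongr
          _ = _ := by ring
    _ ≤ gammaConst d ^ 2 * n := by gcongr

/-! ### Intersections of symmetric convex sets -/

theorem theorem1p2 {n : ℕ} {ι : Type*} [Finite ι]
    (P : ι → Set (EuclideanSpace ℝ (Fin n)))
    (hconv : ∀ i, Convex ℝ (P i))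
    (hsymm : ∀ i, IsSymmetricSet (P i))
    (hint : (interior (⋂ i, P i)).Nonempty)
    (d : ℝ) (hd : 1 < d) :
    ∃ (s : ℕ) (i : Fin s → ι), (s : ℝ) ≤ d * n ∧
      (⋂ j, P (i j)) ⊆ (gammaConst d * √(n : ℝ)) • (⋂ k, P k) := by
  rcases Nat.eq_zero_or_pos n with rfl | hn
  -- For `n = 0` the right-hand side is `0 • K` with `K` nonempty, which is the whole space.
  · obtain ⟨y, hy⟩ := hint
    exact ⟨0, Fin.elim0, by simp, fun x _ ↦ ⟨y, interior_subset hy, Subsingleton.elim _ _⟩⟩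
  have h0 : ∀ i, (0 : EuclideanSpace ℝ (Fin n)) ∈ interior (P i) := fun i ↦
    zero_mem_interior_of_isSymmetricSet (hconv i) (hsymm i)
      (hint.mono (interior_mono (Set.iInter_subset P i)))
  have hV : IsCompact (⋃ i, innerPolar (P i)) := isCompact_iUnion fun i ↦
    Metric.isCompact_of_isClosed_isBounded (isClosed_innerPolar _) (isBounded_innerPolar (h0 i))
  obtain ⟨s, v, hs, hvV, hv⟩ :=
    exists_tuple_lt_gammaConst_mul_sqrt (finrank_euclideanSpace_fin (𝕜 := ℝ)) hn hV hd
  choose i hi using fun j ↦ Set.mem_iUnion.1 (hvV j)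
  have hR : 0 < gammaConst d * √n :=
    mul_pos (gammaConst_pos hd) (Real.sqrt_pos.2 (by exact_mod_cast hn))
  refine ⟨s, i, hs, fun x hx ↦ ?_⟩
  rw [Set.mem_smul_set_iff_inv_smul_mem₀ hR.ne', Set.mem_iInter]
  intro k
  refine inv_smul_mem_of_inner_le (hconv k) (h0 k) hR fun w hw ↦ ?_
  have h := hv (innerₗ _ x) (fun j ↦ by
    rw [innerₗ_apply_apply, real_inner_comm]
    exact abs_inner_le_one_of_mem_innerPolar (hsymm _) (hi j) (Set.mem_iInter.1 hx j)) w
    (Set.mem_iUnion.2 ⟨k, hw⟩)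
  rwa [innerₗ_apply_apply, real_inner_comm] at h
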